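/- Let $n \ge 1$ and let $P_1, \ldots, P_n$ be polytopes in $\mathbb{R}^n$, where a polytope is a nonempty bounded set defined by finitely many linear equations and (weak) inequalities; it is closed and convex, and may have any dimension from $0$ to $n$. For real numbers $c_1, \ldots, c_n$ put $c_1P_1 + \cdots + c_nP_n = \{c_1p_1 + \cdots + c_np_n : p_i \in P_i\}$, and let $\operatorname{Vol}$ denote $n$-dimensional Lebesgue measure. There is a unique real polynomial in $c_1, \ldots, c_n$ that equals $\operatorname{Vol}(c_1P_1 + \cdots + c_nP_n)$ for all $c_1, \ldots, c_n \ge 0$, and it is homogeneous of degree $n$. Let the mixed volume $MV(P_1, \ldots, P_n)$ be the coefficient of $c_1c_2\cdots c_n$ in this polynomial. Then $$MV(P_1, \ldots, P_n) = \sum_{k=0}^{n-1} (-1)^{k} \sum_{\substack{S \subseteq \{1, \ldots, n\} \\ |S| = n-k}} \operatorname{Vol}\Big(\sum_{i \in S} P_i\Big),$$ that is, $MV(P_1, \ldots, P_n) = \operatorname{Vol}(P_1 + \cdots + P_n) - \sum_{i=1}^n \operatorname{Vol}(P_1 + \cdots + \widehat{P_i} + \cdots + P_n) + \cdots + (-1)^{n-1}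 \sum_{i=1}^n \operatorname{Vol}(P_i)$, where $\widehat{P_i}$ means that $P_i$ is omitted. -/

import Mathlib

open scoped Pointwise

/-- A polytope in `ℝⁿ`: a nonempty bounded set cut out by finitely many linear inequalities
`⟪aⱼ, x⟫ ≤ bⱼ` (a linear equation is a pair of opposite inequalities). Such a set is automatically
closed and convex, and it may have any dimension from `0` to `n`. -/
def IsPolytope {n : ℕ} (P : Set (EuclideanSpace ℝ (Fin n))) : Prop :=
  P.Nonempty ∧ Bornology.IsBounded P ∧
    ∃ (m : ℕ) (a : Fin m → EuclideanSpace ℝ (Fin n)) (b : Fin m → ℝ),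
      P = {x | ∀ j, inner ℝ (a j) x ≤ b j}

/-- The polynomial `p` in the variables `c₁, …, cₙ` represents the volume function
`(c₁, …, cₙ) ↦ Vol (c₁ P₁ + ⋯ + cₙ Pₙ)` on nonnegative coefficients. Sums and multiples of sets
are pointwise: `c₁ P₁ + ⋯ + cₙ Pₙ = {c₁ p₁ + ⋯ + cₙ pₙ : pᵢ ∈ Pᵢ}`. -/
def IsVolumePolynomial {n : ℕ} (P : Fin n → Set (EuclideanSpace ℝ (Fin n)))
    (p : MvPolynomial (Fin n) ℝ) : Prop :=
  ∀ c : Fin n → ℝ, (∀ i, 0 ≤ c i) →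
    MvPolynomial.eval c p = MeasureTheory.volume.real (∑ i, c i • P i)

/-- The polynomial representing the volume function of `P₁, …, Pₙ`
(an arbitrary polynomial if there is none). -/
noncomputable def volumePolynomial {n : ℕ} (P : Fin n → Set (EuclideanSpace ℝ (Fin n))) :
    MvPolynomial (Fin n) ℝ :=
  Classical.epsilon (IsVolumePolynomial P)

/-- The mixed volume `MV(P₁, …, Pₙ)`: the coefficient of `c₁ c₂ ⋯ cₙ` in the polynomial
`Vol (c₁ P₁ + ⋯ + cₙ Pₙ)`. -/
noncomputable def mixedVolume {n : ℕ} (P : Fin n → Set (EuclideanSpace ℝ (Fin n))) : ℝ :=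
  MvPolynomial.coeff (Finsupp.equivFunOnFinite.symm fun _ => 1) (volumePolynomial P)

/-!
The substance is Minkowski's theorem that `Vol (c₁ P₁ + ⋯ + cₙ Pₙ)` is a polynomial in `c ≥ 0`;
uniqueness holds because a polynomial is determined by its values on the nonnegative orthant,
homogeneity follows from `Vol (t K) = t ^ n Vol K`, and the formula for the mixed volume is
polarization (`MvPolynomial.IsHomogeneous.coeff_one_eq_sum`): the alternating sum over `S` of the
values at the indicator vectors of `S` kills every monomial in which some variable is missing, and
in degree `n` only `c₁ ⋯ cₙ` contains all variables. The term `S = ∅` is the volume of a point,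
which vanishes for `n ≥ 1`.

Polynomiality is proved by the Cayley trick. Each `Pᵢ` is the convex hull of a finite set
(`IsPolytope.exists_finset_convexHull`). Place its points `v` at `(v, eᵢ)` in `ℝⁿ × ℝⁿ`; then
`c₁ P₁ + ⋯ + cₙ Pₙ` is the slice at height `c` of the cone generated by these vectors
(`sum_smul_convexHull_eq_cayleySlice`). Generic heights on the generators define a regular
subdivision of the cone into simplicial cones. Its cells are the optimal bases of a linear program:
optimality shows that they cover all generic points (`exists_isRegularCell_of_mem`), and comparing
the dual functionals of two cells shows that they overlap only in null sets
(`IsRegularCell.eq_of_mem`). In a simplicial cell, scaling the basis vectors over `eᵢ` by `cᵢ` maps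
the slice at height `(1, …, 1)` linearly onto the slice at height `c`, with a determinant that is
polynomial in `c` (`exists_eval_eq_measureReal_cayleySlice`). Summing over the cells gives the
polynomial for `c > 0`, and continuity of the volume extends it to `c ≥ 0`
(`exists_eval_eq_measureReal_sum_smul`).
-/

/-! ### Polytopes as convex hulls of finite sets -/

/-- A set cut out by finitely many linear inequalities has finitely many extreme points, because an
extreme point is determined by the inequalities that are equalities at it. -/
theorem finite_extremePoints_of_halfspaces {V : Type*} [NormedAddCommGroup V]
    [InnerProductSpace ℝ V] {m : ℕ} (a : Fin m → V) (b : Fin m → ℝ) :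
    (Set.extremePoints ℝ {x : V | ∀ j, inner ℝ (a j) x ≤ b j}).Finite := by
  refine Set.Finite.of_finite_image (f := fun x => {j | inner ℝ (a j) x = b j})
    (Set.toFinite _) ?_
  intro x hx y hy hxy
  by_contra hne
  have hact : ∀ j, inner ℝ (a j) x = b j ↔ inner ℝ (a j) y = b j := fun j =>
    Set.ext_iff.1 hxy j
  rw [mem_extremePoints] at hx hy
  obtain ⟨hxP, hx⟩ := hx
  have hyP := hy.1
  -- For small `t > 0` the point `x + t (x - y)` stays in the set.
  have hev : ∀ᶠ t : ℝ in nhdsWithin 0 (Set.Ioi 0), ∀ j, inner ℝ (a j) (x + t • (x - y)) ≤ b j := by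
    rw [Filter.eventually_all]
    intro j
    by_cases hj : inner ℝ (a j) x = b j
    · refine Filter.Eventually.of_forall fun t => ?_
      rw [inner_add_right, inner_smul_right, inner_sub_right, hj, (hact j).1 hj]
      simp
    · have hlt : inner ℝ (a j) (x + (0 : ℝ) • (x - y)) < b j := by
        simpa using lt_of_le_of_ne (hxP j) hj
      have hc : Continuous fun t : ℝ => inner ℝ (a j) (x + t • (x - y)) := by fun_prop
      filter_upwards [nhdsWithin_le_nhds (hc.continuousAt.eventually_lt continuousAt_const hlt)] with t ht using ht.le
  obtain ⟨t, ht, ht0⟩ := (hev.and self_mem_nhdsWithin).exists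
  have ht0 : 0 < t := ht0
  have hseg : x ∈ openSegment ℝ (x + t • (x - y)) y := by
    refine ⟨1 / (1 + t), t / (1 + t), by positivity, by positivity, by field_simp, ?_⟩
    have h1 : (1 + t) ≠ 0 := by positivity
    have : (1 + t) • ((1 / (1 + t)) • (x + t • (x - y)) + (t / (1 + t)) • y) = (1 + t) • x := by
      rw [smul_add, smul_smul, smul_smul, mul_div_cancel₀ _ h1, mul_div_cancel₀ _ h1]
      module
    exact smul_right_injective V h1 this
  exact hne (hx _ ht _ hyP hseg).2.symm

/-- A polytope is the convex hull of its extreme points, by the Krein–Milman theorem. -/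
theorem IsPolytope.exists_finset_convexHull {n : ℕ} {P : Set (EuclideanSpace ℝ (Fin n))}
    (hP : IsPolytope P) :
    ∃ s : Finset (EuclideanSpace ℝ (Fin n)), s.Nonempty ∧ P = convexHull ℝ (s : Set _) := by
  obtain ⟨hne, hb, m, a, b, hPe⟩ := hP
  have hfin : (Set.extremePoints ℝ P).Finite := hPe ▸ finite_extremePoints_of_halfspaces a b
  have hS : P = ⋂ j, {x | inner ℝ (a j) x ≤ b j} := by rw [hPe]; ext; simp
  have hcl : IsClosed P := by
    rw [hS]
    exact isClosed_iInter fun j => isClosed_le (by fun_prop) continuous_const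
  have hcv : Convex ℝ P := by
    rw [hS]
    exact convex_iInter fun j => convex_halfSpace_le (innerₛₗ ℝ (a j)).isLinear (b j)
  have h := closure_convexHull_extremePoints (Metric.isCompact_of_isClosed_isBounded hcl hb) hcv
  rw [(hfin.isClosed_convexHull ℝ).closure_eq] at h
  refine ⟨hfin.toFinset, ?_, by simpa using h.symm⟩
  rw [← h, convexHull_nonempty_iff] at hne
  simpa using hne

/-! ### Regular subdivision of a finitely generated cone -/

section Cone
variable {E J : Type*} [AddCommGroup E] [Module ℝ E] [Fintype J]

/-- The cone generated by the vectors `a j`, `j ∈ B`, of a finite family `a`. The coefficients are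
indexed by the whole family and vanish off `B`. -/
def coneOn (a : J → E) (B : Finset J) : Set E :=
  {y | ∃ l : J → ℝ, (∀ j, 0 ≤ l j) ∧ (∀ j ∉ B, l j = 0) ∧ ∑ j, l j • a j = y}

/-- A height function `w` is generic for the family `a` if it is the restriction of a linear
functional only on linearly independent subfamilies. -/
def IsGenericWeight (a : J → E) (w : J → ℝ) : Prop :=
  ∀ S : Finset J, (∃ f : E →ₗ[ℝ] ℝ, ∀ j ∈ S, f (a j) = w j) → LinearIndepOn ℝ a (S : Set J)

/-- A vector is generic for the family `a` if it lies in no proper subspace spanned by a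
subfamily. -/
def IsGenericVector (a : J → E) (y : E) : Prop :=
  ∀ S : Finset J, y ∈ Submodule.span ℝ (a '' S) → Submodule.span ℝ (a '' S) = ⊤

/-- The cells of the regular subdivision of the cone over `a` defined by the heights `w`: index sets
of bases for which the linear functional agreeing with `w` on the basis lies strictly below `w` on
all other vectors. -/
def IsRegularCell (a : J → E) (w : J → ℝ) (B : Finset J) : Prop :=
  LinearIndepOn ℝ a (B : Set J) ∧ Submodule.span ℝ (a '' B) = ⊤ ∧
    ∃ f : E →ₗ[ℝ] ℝ, (∀ j ∈ B, f (a j) = w j) ∧ ∀ j ∉ B, f (a j) < w j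

theorem sum_dite_smul {M : Type*} [AddCommGroup M] [Module ℝ M] [DecidableEq J] {B : Finset J}
    (v : J → M) (g : B → ℝ) :
    ∑ j, (if hj : j ∈ B then g ⟨j, hj⟩ else 0) • v j = ∑ j : B, g j • v j := by
  rw [← Finset.sum_subset (Finset.subset_univ B) (fun j _ hj => by simp [hj]),
    ← Finset.sum_coe_sort]
  exact Finset.sum_congr rfl fun j _ => by simp

/-- A linear dependency turns extendability of the heights from a dependent subfamily into a nontrivial
linear equation for the heights, and a real vector space is not a finite union of hyperplanes. -/
theorem exists_isGenericWeight (a : J → E) : ∃ w : J → ℝ, IsGenericWeight a w := by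
  classical
  -- A linear dependency in each dependent subfamily.
  have hdep : ∀ S : {S : Finset J // ¬ LinearIndepOn ℝ a (S : Set J)}, ∃ m : J → ℝ, m ≠ 0 ∧
      (∀ j ∉ S.1, m j = 0) ∧ ∑ j, m j • a j = 0 := by
    rintro ⟨S, hS⟩
    rw [linearIndepOn_finset_iff] at hS
    push Not at hS
    obtain ⟨g, hg, i, hi, hgi⟩ := hS
    refine ⟨fun j => if j ∈ S then g j else 0, fun h => hgi ?_, fun j hj => by simp [hj], ?_⟩
    · simpa [hi] using congrFun h i
    · simpa [ite_smul, Finset.sum_ite_mem] using hg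
  choose m hm0 hmS hm using hdep
  obtain ⟨f, hf⟩ := Module.exists_dual_forall_apply_ne_zero (K := ℝ) m hm0
  refine ⟨fun j => f (Pi.single j 1), fun S ⟨g, hg⟩ => ?_⟩
  by_contra hS
  refine hf ⟨S, hS⟩ ?_
  have h1 : f (m ⟨S, hS⟩) = ∑ j, m ⟨S, hS⟩ j * f (Pi.single j 1) := by
    conv_lhs => rw [pi_eq_sum_univ' (m ⟨S, hS⟩)]
    simp [map_sum]
  have h2 : ∑ j, m ⟨S, hS⟩ j * f (Pi.single j 1) = g (∑ j, m ⟨S, hS⟩ j • a j) := by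
    rw [map_sum]
    refine Finset.sum_congr rfl fun j _ => ?_
    by_cases hj : j ∈ S
    · simp [hg j hj]
    · simp [hmS ⟨S, hS⟩ j hj]
  rw [h1, h2, hm, map_zero]

theorem coneOn_mono (a : J → E) {B C : Finset J} (h : B ⊆ C) : coneOn a B ⊆ coneOn a C :=
  fun _ ⟨l, h0, h1, h2⟩ => ⟨l, h0, fun j hj => h1 j fun hB => hj (h hB), h2⟩

theorem coneOn_subset_span (a : J → E) (B : Finset J) :
    coneOn a B ⊆ Submodule.span ℝ (a '' B) := by
  rintro _ ⟨l, -, h, rfl⟩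
  refine Submodule.sum_mem _ fun j _ => ?_
  by_cases hj : j ∈ B
  · exact Submodule.smul_mem _ _ (Submodule.subset_span ⟨j, hj, rfl⟩)
  · simp [h j hj]

/-- The interiors of two distinct cells are disjoint: a common point of two cells has the same
height in both, which forces it into the cone over the common vectors. -/
theorem IsRegularCell.eq_of_mem {a : J → E} {w : J → ℝ} {B C : Finset J} {y : E}
    (hB : IsRegularCell a w B) (hC : IsRegularCell a w C) (hy : IsGenericVector a y)
    (hyB : y ∈ coneOn a B) (hyC : y ∈ coneOn a C) : B = C := by
  classical
  -- For the functionals `f`, `g` of the cells `B`, `C` both `f y ≤ g y` and `g y ≤ f y` hold, and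
  -- equality forces the coefficients of `y` in `B` to vanish off `C`.
  have key : ∀ {B C : Finset J}, IsRegularCell a w B → IsRegularCell a w C →
      y ∈ coneOn a B → y ∈ coneOn a C → B ⊆ C := by
    rintro B C ⟨hBi, -, f, hfB, hfn⟩ ⟨-, -, g, hgC, hgn⟩ ⟨l, hl0, hlB, hl⟩ ⟨m, hm0, hmC, hm⟩
    have hfle : ∀ j, f (a j) ≤ w j := fun j => by
      by_cases hj : j ∈ B
      · exact (hfB j hj).le
      · exact (hfn j hj).le
    have hgle : ∀ j, g (a j) ≤ w j := fun j => by
      by_cases hj : j ∈ C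
      · exact (hgC j hj).le
      · exact (hgn j hj).le
    have e1 : f y = ∑ j, l j * w j := by
      rw [← hl, map_sum]
      refine Finset.sum_congr rfl fun j _ => ?_
      by_cases hj : j ∈ B
      · simp [hfB j hj]
      · simp [hlB j hj]
    have e2 : g y = ∑ j, m j * w j := by
      rw [← hm, map_sum]
      refine Finset.sum_congr rfl fun j _ => ?_
      by_cases hj : j ∈ C
      · simp [hgC j hj]
      · simp [hmC j hj]
    have e3 : f y ≤ ∑ j, m j * w j := by
      rw [← hm, map_sum]
      exact Finset.sum_le_sum fun j _ => by simpa using mul_le_mul_of_nonneg_left (hfle j) (hm0 j)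
    have e4 : ∑ j, l j * g (a j) = g y := by rw [← hl, map_sum]; simp
    have e5 : ∀ j ∈ Finset.univ, l j * g (a j) ≤ l j * w j := fun j _ =>
      mul_le_mul_of_nonneg_left (hgle j) (hl0 j)
    have e6 := (Finset.sum_eq_sum_iff_of_le e5).1
      (le_antisymm (Finset.sum_le_sum e5) (by rw [e4, ← e1, e2]; exact e3))
    have hlC : ∀ j ∉ C, l j = 0 := fun j hj => by
      have h1 := e6 j (Finset.mem_univ j)
      have h2 := hgn j hj
      rcases mul_eq_mul_left_iff.1 h1 with h | h
      · exact absurd h h2.ne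
      · exact h
    have hBC : y ∈ coneOn a (B ∩ C) := by
      refine ⟨l, hl0, fun j hj => ?_, hl⟩
      rw [Finset.mem_inter, not_and_or] at hj
      exact hj.elim (hlB j) (hlC j)
    have htop := hy _ (coneOn_subset_span a _ hBC)
    intro j hj
    by_contra hjC
    have hsub : ((B ∩ C : Finset J) : Set J) ⊆ (B : Set J) \ {j} := by
      intro k hk
      simp only [Finset.coe_inter, Set.mem_inter_iff, Finset.mem_coe] at hk
      exact ⟨hk.1, fun h => hjC (h ▸ hk.2)⟩
    have := (linearIndepOn_iff_notMem_span.1 hBi) j hj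
    exact this (Submodule.span_mono (Set.image_mono hsub) (htop ▸ Submodule.mem_top))
  exact (key hB hC hyB hyC).antisymm (key hC hB hyC hyB)
end Cone

section Existence
variable {E J : Type*} [NormedAddCommGroup E] [NormedSpace ℝ E] [Fintype J]

/-- At an optimal solution `l` of the linear program `∑ l j * w j → min`, `∑ l j • a j = y`,
`l ≥ 0`, no feasible direction decreases the objective. -/
theorem sum_mul_nonneg_of_isMinOn {a : J → E} {w l d : J → ℝ} {y : E}
    (hl0 : ∀ j, 0 ≤ l j) (hl : ∑ j, l j • a j = y)
    (hmin : ∀ m : J → ℝ, (∀ j, 0 ≤ m j) → ∑ j, m j • a j = y → ∑ j, l j * w j ≤ ∑ j, m j * w j)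
    (hd : ∑ j, d j • a j = 0) (hd0 : ∀ j, l j = 0 → 0 ≤ d j) : 0 ≤ ∑ j, d j * w j := by
  have hev : ∀ᶠ t : ℝ in nhdsWithin 0 (Set.Ioi 0), ∀ j, 0 ≤ l j + t * d j := by
    rw [Filter.eventually_all]
    intro j
    by_cases hj : l j = 0
    · filter_upwards [self_mem_nhdsWithin] with t ht
      have := mul_nonneg (Set.mem_Ioi.1 ht).le (hd0 j hj)
      rw [hj]; linarith
    · have hpos : 0 < l j + 0 * d j := by simpa using lt_of_le_of_ne (hl0 j) (Ne.symm hj)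
      have hc : Continuous fun t : ℝ => l j + t * d j := by fun_prop
      filter_upwards [nhdsWithin_le_nhds (continuousAt_const.eventually_lt hc.continuousAt hpos)] with t ht using ht.le
  obtain ⟨t, ht, ht0⟩ := (hev.and self_mem_nhdsWithin).exists
  have h := hmin (fun j => l j + t * d j) ht (by
    simp only [add_smul, mul_smul, Finset.sum_add_distrib, ← Finset.smul_sum, hl, hd]
    simp)
  have h2 : ∑ j, (l j + t * d j) * w j = ∑ j, l j * w j + t * ∑ j, d j * w j := by
    simp only [add_mul, Finset.sum_add_distrib, Finset.mul_sum, mul_assoc]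
  rw [h2] at h
  exact nonneg_of_mul_nonneg_right (by linarith) (Set.mem_Ioi.1 ht0)

/-- The cells cover the generic points of the cone: the support of an optimal solution of the linear
program `∑ l j * w j → min`, `∑ l j • a j = y`, `l ≥ 0`, is a cell. The functional `h` makes the
set of feasible solutions bounded. -/
theorem exists_isRegularCell_of_mem {a : J → E} {w : J → ℝ} {y : E} (hw : IsGenericWeight a w)
    (h : E →ₗ[ℝ] ℝ) (hh : ∀ j, h (a j) = 1) (hy : IsGenericVector a y)
    (hyc : y ∈ coneOn a Finset.univ) : ∃ B, IsRegularCell a w B ∧ y ∈ coneOn a B := by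
  classical
  have hbd : ∀ m : J → ℝ, (∀ j, 0 ≤ m j) → ∑ j, m j • a j = y → ∀ j, m j ≤ h y := by
    intro m hm0 hm j
    rw [← hm, map_sum]
    simp only [map_smul, hh, smul_eq_mul, mul_one]
    exact Finset.single_le_sum (fun i _ => hm0 i) (Finset.mem_univ j)
  let F : Set (J → ℝ) := {m | (∀ j, 0 ≤ m j) ∧ ∑ j, m j • a j = y}
  have hFc : IsCompact F := by
    refine (isCompact_univ_pi fun _ : J => isCompact_Icc (a := (0 : ℝ)) (b := h y)).of_isClosed_subset
      ?_ fun m hm j _ => ⟨hm.1 j, hbd m hm.1 hm.2 j⟩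
    refine IsClosed.and ?_ (isClosed_eq (by fun_prop) continuous_const)
    simp only [Set.ofPred_forall]
    exact isClosed_iInter fun j => isClosed_le continuous_const (continuous_apply j)
  obtain ⟨l', h0', -, h1'⟩ := hyc
  obtain ⟨l, ⟨hl0, hl⟩, hmin⟩ := hFc.exists_isMinOn (f := fun m => ∑ j, m j * w j) ⟨l', h0', h1'⟩
    (by fun_prop : Continuous _).continuousOn
  have hopt : ∀ d : J → ℝ, ∑ j, d j • a j = 0 → (∀ j, l j = 0 → 0 ≤ d j) →
      0 ≤ ∑ j, d j * w j := fun d =>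
    sum_mul_nonneg_of_isMinOn hl0 hl fun m hm0 hm => hmin (a := m) ⟨hm0, hm⟩
  let B : Finset J := Finset.univ.filter fun j => l j ≠ 0
  have hB : ∀ j, j ∈ B ↔ l j ≠ 0 := fun j => by simp [B]
  have hyB : y ∈ coneOn a B := ⟨l, hl0, fun j hj => by simpa [hB] using hj, hl⟩
  have hspan := hy _ (coneOn_subset_span a B hyB)
  -- On the support, the heights vanish on all linear relations, hence come from a functional.
  obtain ⟨f, hf⟩ : ∃ f : E →ₗ[ℝ] ℝ, ∀ j ∈ B, f (a j) = w j := by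
    let A : (B → ℝ) →ₗ[ℝ] E := Fintype.linearCombination ℝ fun j : B => a j
    let W : (B → ℝ) →ₗ[ℝ] ℝ := Fintype.linearCombination ℝ fun j : B => w j
    have hW : W ∈ (LinearMap.ker A).dualAnnihilator := by
      rw [Submodule.mem_dualAnnihilator]
      intro g hg
      have hg : ∑ j : B, g j • a j = 0 := by
        simpa [A, Fintype.linearCombination_apply] using hg
      have hpos : ∀ g : B → ℝ, ∑ j : B, g j • a j = 0 → 0 ≤ W g := by
        intro g hg
        have := hopt (fun j => if hj : j ∈ B then g ⟨j, hj⟩ else 0) (by rw [sum_dite_smul, hg])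
          (fun j hj => by simp [hB, hj])
        simpa only [W, Fintype.linearCombination_apply, ← smul_eq_mul, sum_dite_smul] using this
      refine le_antisymm ?_ (hpos g hg)
      have := hpos (-g) (by simp only [Pi.neg_apply, neg_smul, Finset.sum_neg_distrib, hg, neg_zero])
      rw [map_neg] at this
      linarith
    rw [← LinearMap.range_dualMap_eq_dualAnnihilator_ker] at hW
    obtain ⟨f, hf⟩ := hW
    refine ⟨f, fun j hj => ?_⟩
    have := LinearMap.congr_fun hf (Pi.single ⟨j, hj⟩ 1)
    simpa [A, W, LinearMap.dualMap_apply, Fintype.linearCombination_apply_single] using this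
  refine ⟨B, ⟨hw B ⟨f, hf⟩, hspan, f, hf, fun v hv => lt_of_le_of_ne ?_ fun heq => ?_⟩, hyB⟩
  · -- Move from `l` towards `v`, compensating within the basis `B`.
    have hv' : a v ∈ Submodule.span ℝ (a '' B) := hspan ▸ Submodule.mem_top
    rw [Submodule.mem_span_image_finset_iff_exists_fun] at hv'
    obtain ⟨c, hc⟩ := hv'
    have hc : ∑ j : B, c j • a j = a v := hc
    have h2 : ∑ j : B, c j * w j = f (a v) := by
      rw [← hc, map_sum]
      exact Finset.sum_congr rfl fun j _ => by simp [hf j j.2]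
    have := hopt (fun j => (Pi.single v (1 : ℝ) : J → ℝ) j - if hj : j ∈ B then c ⟨j, hj⟩ else 0)
      (by
        simp only [sub_smul, Finset.sum_sub_distrib, sum_dite_smul, hc]
        simp [Pi.single_apply, ite_smul])
      (fun j hj => by
        have : j ∉ B := by simp [hB, hj]
        simp only [this, dif_neg, not_false_eq_true, sub_zero, Pi.single_apply]
        split_ifs <;> norm_num)
    simp only [← smul_eq_mul, sub_smul, Finset.sum_sub_distrib, sum_dite_smul] at this
    simp only [smul_eq_mul, h2] at this
    simp only [Pi.single_apply, ite_mul, one_mul, zero_mul, Finset.sum_ite_eq', Finset.mem_univ,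
      if_true] at this
    linarith
  · have hins := hw (insert v B) ⟨f, fun j hj => by
      rcases Finset.mem_insert.1 hj with rfl | hj
      · exact heq
      · exact hf j hj⟩
    refine linearIndepOn_iff_notMem_span.1 hins v (by simp) ?_
    have : ((insert v B : Finset J) : Set J) \ {v} = B := by
      simp [hv]
    rw [this, hspan]
    exact Submodule.mem_top
end Existence

/-! ### Slices of the Cayley cone -/

section Slices
variable {V ι J : Type*} [NormedAddCommGroup V] [NormedSpace ℝ V] [Fintype ι] [DecidableEq ι]

/-- The Cayley embedding of a family of vectors `v j`, each belonging to the configuration with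
label `k j`: the `j`-th vector is placed over the basis vector labelled `k j`. -/
def cayley (v : J → V) (k : J → ι) (j : J) : V × (ι → ℝ) := (v j, Pi.single (k j) 1)

/-- The slice at height `c` of the cone generated by the Cayley vectors with index in `B`. -/
def cayleySlice [Fintype J] (v : J → V) (k : J → ι) (B : Finset J) (c : ι → ℝ) : Set V :=
  {x | (x, c) ∈ coneOn (cayley v k) B}

/-- A subspace spanned by Cayley vectors that contains a whole slice `V × {c}`, with all `c i`
nonzero, is everything. -/
theorem span_cayley_eq_top {v : J → V} {k : J → ι} {S : Set J} {c : ι → ℝ} (hc : ∀ i, c i ≠ 0)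
    (h : ∀ x : V, (x, c) ∈ Submodule.span ℝ (cayley v k '' S)) :
    Submodule.span ℝ (cayley v k '' S) = ⊤ := by
  set W := Submodule.span ℝ (cayley v k '' S) with hW
  have h1 : ∀ x : V, (x, (0 : ι → ℝ)) ∈ W := fun x => by
    simpa using W.sub_mem (h x) (h 0)
  have h2 : ∀ i, ∃ j ∈ S, k j = i := by
    intro i
    by_contra! hi
    have hle : W ≤ LinearMap.ker ((LinearMap.proj i : (ι → ℝ) →ₗ[ℝ] ℝ) ∘ₗ LinearMap.snd ℝ V _) := by
      rw [hW, Submodule.span_le]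
      rintro _ ⟨j, hj, rfl⟩
      simp [cayley, (hi j hj).symm]
    exact hc i (by simpa using hle (h 0))
  have h3 : ∀ i, ((0 : V), (Pi.single i 1 : ι → ℝ)) ∈ W := by
    intro i
    obtain ⟨j, hj, rfl⟩ := h2 i
    simpa [cayley] using W.sub_mem (Submodule.subset_span ⟨j, hj, rfl⟩ : cayley v k j ∈ W) (h1 (v j))
  rw [eq_top_iff]
  rintro ⟨x, u⟩ -
  have hxu : (x, u) = (x, (0 : ι → ℝ)) + ∑ i, u i • ((0 : V), (Pi.single i 1 : ι → ℝ)) := by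
    ext1
    · simp [Prod.fst_sum]
    · simp only [Prod.snd_add, Prod.snd_sum, Prod.smul_snd, zero_add]
      exact pi_eq_sum_univ' u
  rw [hxu]
  exact W.add_mem (h1 x) (W.sum_mem fun i _ => W.smul_mem _ (h3 i))

variable [FiniteDimensional ℝ V] [MeasurableSpace V] [BorelSpace V]
  (μ : MeasureTheory.Measure V) [μ.IsAddHaarMeasure] [Fintype J]

/-- Almost every point of a slice at a height with nonzero entries is generic: the exceptional points
lie in finitely many proper affine subspaces. -/
theorem ae_isGenericVector_cayley (v : J → V) (k : J → ι) {c : ι → ℝ} (hc : ∀ i, c i ≠ 0) :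
    ∀ᵐ x ∂μ, IsGenericVector (cayley v k) (x, c) := by
  unfold IsGenericVector
  rw [MeasureTheory.ae_all_iff]
  intro S
  by_cases hS : Submodule.span ℝ (cayley v k '' (S : Set J)) = ⊤
  · exact Filter.Eventually.of_forall fun _ _ => hS
  let A : AffineSubspace ℝ V :=
    (Submodule.span ℝ (cayley v k '' (S : Set J))).toAffineSubspace.comap
      ((AffineMap.id ℝ V).prod (AffineMap.const ℝ V c))
  have hA : ∀ x, x ∈ A ↔ (x, c) ∈ Submodule.span ℝ (cayley v k '' (S : Set J)) := fun x => by
    simp [A, AffineSubspace.mem_comap]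
  have hne : A ≠ ⊤ := fun h => hS <| span_cayley_eq_top hc fun x => by
    rw [← hA, h]; exact AffineSubspace.mem_top ℝ V x
  have h0 := MeasureTheory.Measure.addHaar_affineSubspace μ A hne
  filter_upwards [MeasureTheory.measure_eq_zero_iff_ae_notMem.1 h0] with x hx hxS
  exact absurd ((hA x).2 hxS) hx

/-- The cone over linearly independent vectors is closed, being given by the signs of the
coordinates. -/
theorem isClosed_coneOn_of_basis {E : Type*} [NormedAddCommGroup E] [NormedSpace ℝ E]
    [FiniteDimensional ℝ E] {a : J → E} {B : Finset J}
    (b : Module.Basis B ℝ E) (hb : ∀ j, b j = a j) : IsClosed (coneOn a B) := by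
  classical
  have hcone : coneOn a B = ⋂ j, {y | 0 ≤ b.coord j y} := by
    ext y
    simp only [Set.mem_iInter, Set.mem_ofPred_eq, Module.Basis.coord_apply]
    constructor
    · rintro ⟨l, hl0, hlB, rfl⟩ j
      have : ∑ j, l j • a j = ∑ j : B, l j • b j := by
        rw [← Finset.sum_subset (Finset.subset_univ B) (fun j _ hj => by simp [hlB j hj]),
          ← Finset.sum_coe_sort]
        exact Finset.sum_congr rfl fun j _ => by rw [hb]
      rw [this, b.repr_sum_self fun j : B => l j]
      exact hl0 j
    · intro h
      refine ⟨fun j => if hj : j ∈ B then b.repr y ⟨j, hj⟩ else 0, fun j => ?_,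
        fun j hj => by simp [hj], ?_⟩
      · dsimp only
        split_ifs
        exacts [h _, le_rfl]
      · rw [sum_dite_smul a fun j => b.repr y j]
        simp only [← hb]
        exact b.sum_repr y
  rw [hcone]
  exact isClosed_iInter fun j =>
    isClosed_le continuous_const (LinearMap.continuous_of_finiteDimensional _)

/-- The determinant of a linear combination of endomorphisms is a polynomial in the
coefficients. -/
theorem exists_eval_eq_det {V ι : Type*} [AddCommGroup V] [Module ℝ V] [FiniteDimensional ℝ V]
    [Fintype ι] (N : ι → V →ₗ[ℝ] V) :
    ∃ p : MvPolynomial ι ℝ, ∀ c : ι → ℝ, p.eval c = LinearMap.det (∑ i, c i • N i) := by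
  classical
  let b := Module.finBasis ℝ V
  refine ⟨(∑ i, (MvPolynomial.X i : MvPolynomial ι ℝ) •
    (LinearMap.toMatrix b b (N i)).map MvPolynomial.C).det, fun c => ?_⟩
  rw [RingHom.map_det, ← LinearMap.det_toMatrix b]
  congr 1
  ext r s
  simp [Matrix.sum_apply]

/-- The slices of the cone over a basis of Cayley vectors are affine images of each other: scaling
the basis vectors with label `i` by `c i` carries the slice at height `1` onto the slice at height
`c`, and the determinant of the induced map of `V` is a polynomial in `c`. -/
theorem exists_eval_eq_measureReal_cayleySlice (v : J → V) (k : J → ι) {B : Finset J}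
    (hB : LinearIndepOn ℝ (cayley v k) (B : Set J))
    (hBt : Submodule.span ℝ (cayley v k '' B) = ⊤) :
    ∃ p : MvPolynomial ι ℝ, ∀ c : ι → ℝ, (∀ i, 0 < c i) →
      p.eval c = μ.real (cayleySlice v k B c) := by
  classical
  let b : Module.Basis B ℝ (V × (ι → ℝ)) := Module.Basis.mk (v := fun j : B => cayley v k j) hB
    (by rw [← hBt, Set.image_eq_range]; exact le_rfl)
  have hb : ∀ j : B, b j = cayley v k j := fun j => Module.Basis.mk_apply _ _ j
  -- `D c` scales the basis vectors with label `i` by `c i`; it multiplies heights by `c`.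
  let D : (ι → ℝ) → (V × (ι → ℝ)) →ₗ[ℝ] (V × (ι → ℝ)) := fun c =>
    b.constr ℝ fun j => c (k j) • cayley v k j
  have hD : ∀ c j, j ∈ B → D c (cayley v k j) = c (k j) • cayley v k j := fun c j hj => by
    have := b.constr_basis ℝ (fun j : B => c (k j) • cayley v k j) ⟨j, hj⟩
    rwa [hb] at this
  have hDmul : ∀ c c' y, D c (D c' y) = D (c * c') y := by
    intro c c' y
    have : D c ∘ₗ D c' = D (c * c') := b.ext fun j => by
      simp [hb, hD _ _ j.2, smul_smul, mul_comm]
    exact LinearMap.congr_fun this y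
  have hDone : ∀ y, D 1 y = y := by
    intro y
    have : D 1 = LinearMap.id := b.ext fun j => by simp [hb, hD _ _ j.2]
    exact LinearMap.congr_fun this y
  have hDsnd : ∀ c y, (D c y).2 = c * y.2 := by
    intro c y
    have : LinearMap.snd ℝ V (ι → ℝ) ∘ₗ D c = LinearMap.mulLeft ℝ c ∘ₗ LinearMap.snd ℝ V (ι → ℝ) :=
      b.ext fun j => by
        rw [LinearMap.comp_apply, LinearMap.comp_apply, hb, hD _ _ j.2]
        ext i
        by_cases hi : i = k j
        · subst hi; simp [cayley]
        · simp [cayley, hi]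
    exact LinearMap.congr_fun this y
  have hDsum : ∀ c, D c = ∑ i, c i • D (Pi.single i 1) := by
    intro c
    refine b.ext fun j => ?_
    simp [hb, hD _ _ j.2, LinearMap.sum_apply, Pi.single_apply]
  have hDcone : ∀ c : ι → ℝ, (∀ i, 0 ≤ c i) → ∀ y ∈ coneOn (cayley v k) B,
      D c y ∈ coneOn (cayley v k) B := by
    rintro c hc _ ⟨l, hl0, hlB, rfl⟩
    refine ⟨fun j => l j * c (k j), fun j => mul_nonneg (hl0 j) (hc _),
      fun j hj => by simp [hlB j hj], ?_⟩
    rw [map_sum]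
    refine Finset.sum_congr rfl fun j _ => ?_
    by_cases hj : j ∈ B
    · rw [map_smul, hD c j hj, smul_smul]
    · simp [hlB j hj]
  -- The restriction of `D c` to the subspace `V × {0}`, which it preserves.
  let N : (ι → ℝ) → V →ₗ[ℝ] V := fun c => LinearMap.fst ℝ V _ ∘ₗ D c ∘ₗ LinearMap.inl ℝ V _
  have hN : ∀ c x, D c (x, 0) = (N c x, 0) := fun c x => by
    ext1
    · rfl
    · simp [hDsnd]
  have hNsum : ∀ c, N c = ∑ i, c i • N (Pi.single i 1) := by
    intro c
    ext x
    simp only [N, LinearMap.comp_apply, LinearMap.inl_apply, LinearMap.fst_apply,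
      LinearMap.sum_apply, LinearMap.smul_apply]
    rw [hDsum c]
    simp [LinearMap.sum_apply, Prod.fst_sum]
  have hNmul : ∀ c c', N (c * c') = N c * N c' := by
    intro c c'
    ext x
    have h1 := hDmul c c' (x, 0)
    rw [hN, hN, hN] at h1
    exact (congrArg Prod.fst h1).symm
  -- The determinant is nonnegative, being the square of the determinant for the square roots.
  have hdet : ∀ c : ι → ℝ, (∀ i, 0 ≤ c i) → 0 ≤ LinearMap.det (N c) := by
    intro c hc
    have : c = (fun i => √(c i)) * (fun i => √(c i)) := by
      ext i; simp [Real.mul_self_sqrt (hc i)]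
    rw [this, hNmul, map_mul]
    exact mul_self_nonneg _
  have hslice : ∀ c : ι → ℝ, (∀ i, 0 < c i) → cayleySlice v k B c =
      (fun x => x + (D c (0, 1)).1) '' (N c '' cayleySlice v k B 1) := by
    intro c hc
    have hDx : ∀ x, D c (x, 1) = (N c x + (D c (0, 1)).1, c) := by
      intro x
      have : ((x, 1) : V × (ι → ℝ)) = (x, 0) + (0, 1) := by simp
      rw [this, map_add, hN]
      ext1
      · simp
      · simp [hDsnd]
    ext x
    simp only [Set.mem_image, exists_exists_and_eq_and]
    constructor
    · intro hx
      have h1 := hDcone c⁻¹ (fun i => (inv_pos.2 (hc i)).le) _ hx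
      have hcc : c * c⁻¹ = 1 := by ext i; simp [(hc i).ne']
      have h2 : D c⁻¹ (x, c) = ((D c⁻¹ (x, c)).1, 1) := by
        ext1
        · rfl
        · rw [hDsnd]; simpa [mul_comm] using hcc
      refine ⟨(D c⁻¹ (x, c)).1, ?_, ?_⟩
      · rw [h2] at h1
        exact h1
      · have h3 := hDmul c c⁻¹ (x, c)
        rw [hcc, hDone, h2, hDx] at h3
        exact congrArg Prod.fst h3
    · rintro ⟨y, hy, rfl⟩
      have := hDcone c (fun i => (hc i).le) _ hy
      rwa [hDx] at this
  obtain ⟨p, hp⟩ := exists_eval_eq_det fun i => N (Pi.single i 1)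
  refine ⟨p * MvPolynomial.C (μ.real (cayleySlice v k B 1)), fun c hc => ?_⟩
  rw [hslice c hc, MeasureTheory.measureReal_def, MeasureTheory.measureReal_def, Set.image_add_right,
    MeasureTheory.measure_preimage_add_right, MeasureTheory.Measure.addHaar_image_linearMap,
    ENNReal.toReal_mul, ENNReal.toReal_ofReal (abs_nonneg _),
    abs_of_nonneg (hdet c fun i => (hc i).le), map_mul, hp, ← hNsum, MvPolynomial.eval_C]

/-- The regular cells for a generic height function decompose the slices of the Cayley cone, up to
null sets, so that the volume of the slices is a polynomial. -/
theorem exists_eval_eq_measureReal_cayleySlice_univ (v : J → V) (k : J → ι)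
    (hfin : ∀ c : ι → ℝ, (∀ i, 0 < c i) → μ (cayleySlice v k Finset.univ c) ≠ ⊤) :
    ∃ p : MvPolynomial ι ℝ, ∀ c : ι → ℝ, (∀ i, 0 < c i) →
      p.eval c = μ.real (cayleySlice v k Finset.univ c) := by
  classical
  obtain ⟨w, hw⟩ := exists_isGenericWeight (cayley v k)
  have hex : ∀ B : Finset J, ∃ p : MvPolynomial ι ℝ, IsRegularCell (cayley v k) w B →
      ∀ c : ι → ℝ, (∀ i, 0 < c i) → p.eval c = μ.real (cayleySlice v k B c) := by
    intro B
    by_cases hB : IsRegularCell (cayley v k) w B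
    · obtain ⟨p, hp⟩ := exists_eval_eq_measureReal_cayleySlice μ v k hB.1 hB.2.1
      exact ⟨p, fun _ => hp⟩
    · exact ⟨0, fun h => absurd h hB⟩
  choose p hp using hex
  let T : Finset (Finset J) := Finset.univ.filter (IsRegularCell (cayley v k) w)
  have hT : ∀ B ∈ T, IsRegularCell (cayley v k) w B := fun B hB => (Finset.mem_filter.1 hB).2
  refine ⟨∑ B ∈ T, p B, fun c hc => ?_⟩
  have hgen := ae_isGenericVector_cayley μ v k (c := c) fun i => (hc i).ne'
  have hsub : ∀ B, cayleySlice v k B c ⊆ cayleySlice v k Finset.univ c := fun B x hx =>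
    coneOn_mono _ (Finset.subset_univ B) hx
  have hunion : cayleySlice v k Finset.univ c =ᵐ[μ] ⋃ B ∈ T, cayleySlice v k B c := by
    filter_upwards [hgen] with x hx
    refine propext ⟨fun hxc => ?_, fun hxc => ?_⟩
    · obtain ⟨B, hB, hxB⟩ := exists_isRegularCell_of_mem hw
        (∑ i, (LinearMap.proj i : (ι → ℝ) →ₗ[ℝ] ℝ) ∘ₗ LinearMap.snd ℝ V _)
        (fun j => by simp [cayley, LinearMap.sum_apply, Pi.single_apply]) hx hxc
      exact Set.mem_biUnion (Finset.mem_filter.2 ⟨Finset.mem_univ B, hB⟩ : B ∈ T) hxB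
    · obtain ⟨B, -, hxB⟩ := Set.mem_iUnion₂.1 hxc
      exact hsub B hxB
  rw [MeasureTheory.measureReal_congr hunion, MeasureTheory.measureReal_biUnion_finset₀ _ _
    fun B _ => MeasureTheory.measure_ne_top_of_subset (hsub B) (hfin c hc), map_sum]
  · exact Finset.sum_congr rfl fun B hB => hp B (hT B hB) c hc
  · intro B hB C hC hBC
    refine MeasureTheory.measure_eq_zero_iff_ae_notMem.2 ?_
    filter_upwards [hgen] with x hx hxBC
    exact hBC ((hT B hB).eq_of_mem (hT C hC) hx hxBC.1 hxBC.2)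
  · intro B hB
    let b : Module.Basis B ℝ (V × (ι → ℝ)) :=
      Module.Basis.mk (v := fun j : B => cayley v k j) (hT B hB).1
        (by rw [← (hT B hB).2.1, Set.image_eq_range]; exact le_rfl)
    have hcl := isClosed_coneOn_of_basis (a := cayley v k) b fun j => Module.Basis.mk_apply _ _ j
    exact (hcl.preimage (by fun_prop : Continuous fun x : V => (x, c))).nullMeasurableSet
end Slices

/-! ### Polynomiality of the volume of Minkowski sums -/

section Minkowski
variable {V ι : Type*} [NormedAddCommGroup V] [NormedSpace ℝ V] [Fintype ι]

theorem isCompact_sum_smul {P : ι → Set V} (hP : ∀ i, IsCompact (P i)) (c : ι → ℝ) :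
    IsCompact (∑ i, c i • P i) := by
  classical
  exact Finset.sum_induction _ IsCompact (fun _ _ => IsCompact.add) isCompact_singleton
    fun i _ => (hP i).smul (c i)

/-- The Cayley trick: Minkowski combinations of polytopes are slices of the cone over the Cayley
vectors of their vertices. -/
theorem sum_smul_convexHull_eq_cayleySlice [DecidableEq ι] (s : ι → Finset V)
    (hs : ∀ i, (s i).Nonempty) {c : ι → ℝ} (hc : ∀ i, 0 ≤ c i) :
    ∑ i, c i • convexHull ℝ (s i : Set V) =
      cayleySlice (fun j : Σ i, s i => (j.2 : V)) Sigma.fst Finset.univ c := by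
  ext x
  rw [Set.mem_fintype_sum]
  constructor
  · rintro ⟨g, hg, rfl⟩
    have hw : ∀ i, ∃ w : V → ℝ, (∀ y ∈ s i, 0 ≤ w y) ∧ ∑ y ∈ s i, w y = 1 ∧
        c i • ∑ y ∈ s i, w y • y = g i := by
      intro i
      obtain ⟨q, hq, hqg⟩ := hg i
      obtain ⟨w, h0, h1, rfl⟩ := Finset.mem_convexHull'.1 hq
      exact ⟨w, h0, h1, hqg⟩
    choose w hw0 hw1 hwg using hw
    refine ⟨fun j => c j.1 * w j.1 j.2, fun j => mul_nonneg (hc _) (hw0 _ _ j.2.2),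
      fun j hj => absurd (Finset.mem_univ j) hj, ?_⟩
    ext1
    · simp only [cayley, Prod.fst_sum, Prod.smul_fst, Fintype.sum_sigma]
      refine Finset.sum_congr rfl fun i _ => ?_
      rw [← hwg i, Finset.smul_sum, ← Finset.sum_coe_sort (s i) fun y => c i • w i y • y]
      simp only [mul_smul]
    · ext i
      simp only [cayley, Prod.snd_sum, Prod.smul_snd, Fintype.sum_sigma, Finset.sum_apply,
        Pi.smul_apply, Pi.single_apply, smul_eq_mul, mul_ite, mul_one, mul_zero]
      rw [Finset.sum_eq_single i (fun k _ hk => by simp [hk.symm]) (by simp)]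
      simp only [if_true]
      rw [Finset.sum_coe_sort (s i) (fun y => c i * w i y), ← Finset.mul_sum, hw1, mul_one]
  · rintro ⟨l, hl0, -, hl⟩
    have h1 := congrArg Prod.fst hl
    have h2 : ∀ i, ∑ y : s i, l ⟨i, y⟩ = c i := by
      intro i
      have := congrFun (congrArg Prod.snd hl) i
      simp only [cayley, Prod.snd_sum, Prod.smul_snd, Fintype.sum_sigma, Finset.sum_apply,
        Pi.smul_apply, Pi.single_apply, smul_eq_mul, mul_ite, mul_one, mul_zero] at this
      rw [Finset.sum_eq_single i (fun k _ hk => by simp [hk.symm]) (by simp)] at this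
      simpa using this
    simp only [cayley, Prod.fst_sum, Prod.smul_fst, Fintype.sum_sigma] at h1
    refine ⟨_, fun i => ?_, h1⟩
    rcases (hc i).eq_or_lt with h | h
    · have h0 : ∀ y : s i, l ⟨i, y⟩ = 0 := fun y =>
        (Finset.sum_eq_zero_iff_of_nonneg fun y _ => hl0 _).1 ((h2 i).trans h.symm) y
          (Finset.mem_univ y)
      obtain ⟨y, hy⟩ := hs i
      exact ⟨y, subset_convexHull ℝ _ hy, by simp [h0, ← h]⟩
    · refine ⟨∑ y : s i, (l ⟨i, y⟩ / c i) • (y : V), ?_, ?_⟩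
      · refine (convex_convexHull ℝ _).sum_mem (fun y _ => div_nonneg (hl0 _) h.le) ?_
          fun y _ => subset_convexHull ℝ _ y.2
        rw [← Finset.sum_div, h2, div_self h.ne']
      · simp only [Finset.smul_sum, smul_smul, mul_div_cancel₀ _ h.ne']

variable [FiniteDimensional ℝ V] [MeasurableSpace V] [BorelSpace V]
  (μ : MeasureTheory.Measure V) [μ.IsAddHaarMeasure]

/-- Squeeze `K + t • L` between a translate of `K` and a thickening of `K`. -/
theorem tendsto_measureReal_add_smul {K L : Set V} (hK : IsCompact K) (hL : IsCompact L)
    (hLne : L.Nonempty) :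
    Filter.Tendsto (fun t : ℝ => μ.real (K + t • L)) (nhdsWithin 0 (Set.Ioi 0))
      (nhds (μ.real K)) := by
  have : ProperSpace V := FiniteDimensional.proper_real V
  refine (ENNReal.tendsto_toReal hK.measure_ne_top).comp ?_
  obtain ⟨R, hR⟩ := hL.isBounded.subset_closedBall 0
  obtain ⟨x, hx⟩ := hLne
  have hthick : Filter.Tendsto (fun t : ℝ => μ (Metric.cthickening (t * R) K))
      (nhdsWithin 0 (Set.Ioi 0)) (nhds (μ K)) := by
    refine (tendsto_measure_cthickening_of_isCompact hK).comp ?_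
    have : Filter.Tendsto (fun t : ℝ => t * R) (nhds 0) (nhds (0 * R)) :=
      (continuous_mul_const R).tendsto 0
    rw [zero_mul] at this
    exact this.mono_left nhdsWithin_le_nhds
  refine tendsto_of_tendsto_of_tendsto_of_le_of_le' tendsto_const_nhds hthick
    (Filter.Eventually.of_forall fun t => ?_) ?_
  · -- The sum contains a translate of `K`.
    have hsub : (fun y => y + t • x) '' K ⊆ K + t • L := by
      rintro _ ⟨y, hy, rfl⟩
      exact Set.add_mem_add hy (Set.smul_mem_smul_set hx)
    have := MeasureTheory.measure_mono (μ := μ) hsub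
    rwa [Set.image_add_right, MeasureTheory.measure_preimage_add_right] at this
  · filter_upwards [self_mem_nhdsWithin] with t ht
    refine MeasureTheory.measure_mono ?_
    rintro _ ⟨y, hy, _, ⟨z, hz, rfl⟩, rfl⟩
    refine Metric.mem_cthickening_of_dist_le _ y _ _ hy ?_
    have hzR : ‖z‖ ≤ R := by simpa using hR hz
    have ht : 0 < t := ht
    simp only [dist_self_add_left, norm_smul, Real.norm_of_nonneg ht.le]
    gcongr

/-- Minkowski's theorem for polytopes: the volume of a nonnegative Minkowski combination is a
polynomial in the coefficients. -/
theorem exists_eval_eq_measureReal_sum_smul (s : ι → Finset V) (hs : ∀ i, (s i).Nonempty) :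
    ∃ p : MvPolynomial ι ℝ, ∀ c : ι → ℝ, (∀ i, 0 ≤ c i) →
      p.eval c = μ.real (∑ i, c i • convexHull ℝ (s i : Set V)) := by
  classical
  have hcpt : ∀ c : ι → ℝ, IsCompact (∑ i, c i • convexHull ℝ (s i : Set V)) :=
    isCompact_sum_smul fun i => (s i).finite_toSet.isCompact_convexHull ℝ
  obtain ⟨p, hp⟩ := exists_eval_eq_measureReal_cayleySlice_univ μ
    (fun j : Σ i, s i => (j.2 : V)) Sigma.fst fun c hc => by
      rw [← sum_smul_convexHull_eq_cayleySlice s hs fun i => (hc i).le]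
      exact (hcpt c).measure_ne_top
  refine ⟨p, fun c hc => ?_⟩
  -- Both sides are continuous along `c + t (1, …, 1)` as `t` decreases to `0`.
  have h1 : Filter.Tendsto (fun t : ℝ => p.eval fun i => c i + t) (nhdsWithin 0 (Set.Ioi 0))
      (nhds (p.eval c)) := by
    have : Continuous fun t : ℝ => p.eval fun i => c i + t :=
      (MvPolynomial.continuous_eval p).comp (by fun_prop)
    simpa using (this.tendsto 0).mono_left nhdsWithin_le_nhds
  have hLne : (∑ i, convexHull ℝ (s i : Set V)).Nonempty :=
    Finset.sum_induction _ Set.Nonempty (fun _ _ => Set.Nonempty.add) ⟨0, rfl⟩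
      fun i _ => convexHull_nonempty_iff.2 (hs i)
  have h2 := tendsto_measureReal_add_smul μ (hcpt c)
    (by simpa using hcpt 1 : IsCompact (∑ i, convexHull ℝ (s i : Set V))) hLne
  refine tendsto_nhds_unique h1 (h2.congr' ?_)
  filter_upwards [self_mem_nhdsWithin] with t ht
  have ht : 0 < t := ht
  rw [hp _ fun i => add_pos_of_nonneg_of_pos (hc i) ht,
    ← sum_smul_convexHull_eq_cayleySlice s hs fun i => add_nonneg (hc i) ht.le,
    Finset.smul_sum, ← Finset.sum_add_distrib]
  congr 1
  exact Finset.sum_congr rfl fun i _ => ((convex_convexHull ℝ _).add_smul (hc i) ht.le).symm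
end Minkowski

/-! ### Extraction of the multilinear coefficient -/

section Coefficient
variable {σ : Type*} [Fintype σ] [DecidableEq σ]

/-- For a monomial, the alternating sum over the vertices of the unit cube tests whether all
variables occur. -/
theorem sum_neg_one_pow_mul_prod_indicator (m : σ →₀ ℕ) :
    ∑ S : Finset σ, (-1 : ℝ) ^ (Fintype.card σ - S.card) *
      ∏ i, (if i ∈ S then (1 : ℝ) else 0) ^ m i = if ∀ i, m i ≠ 0 then 1 else 0 := by
  have h1 : ∏ i, ((1 : ℝ) + -(0 : ℝ) ^ m i) = if ∀ i, m i ≠ 0 then 1 else 0 := by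
    split_ifs with h
    · exact Finset.prod_eq_one fun i _ => by simp [h i]
    · push Not at h
      obtain ⟨i, hi⟩ := h
      exact Finset.prod_eq_zero (Finset.mem_univ i) (by simp [hi])
  rw [← h1, Finset.prod_add, Finset.powerset_univ]
  refine Finset.sum_congr rfl fun S _ => ?_
  rw [Finset.prod_const_one, one_mul, Finset.prod_neg, ← Finset.compl_eq_univ_sdiff,
    Finset.card_compl]
  congr 1
  rw [← Finset.prod_compl_mul_prod S]
  rw [Finset.prod_eq_one (s := S) fun i hi => by simp [hi], mul_one]
  exact Finset.prod_congr rfl fun i hi => by simp [Finset.mem_compl.1 hi]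

/-- Polarization: in a form of degree equal to the number of variables, the multilinear monomial is
the only one in which all variables occur, so its coefficient is an alternating sum of values. -/
theorem MvPolynomial.IsHomogeneous.coeff_one_eq_sum {p : MvPolynomial σ ℝ}
    (hp : p.IsHomogeneous (Fintype.card σ)) :
    p.coeff (Finsupp.equivFunOnFinite.symm fun _ => 1) =
      ∑ S : Finset σ, (-1 : ℝ) ^ (Fintype.card σ - S.card) *
        p.eval (fun i => if i ∈ S then 1 else 0) := by
  simp only [MvPolynomial.eval_eq', Finset.mul_sum]
  rw [Finset.sum_comm]
  have h : ∀ m ∈ p.support, ∑ S : Finset σ, (-1 : ℝ) ^ (Fintype.card σ - S.card) *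
      (p.coeff m * ∏ i, (if i ∈ S then (1 : ℝ) else 0) ^ m i) =
      if m = Finsupp.equivFunOnFinite.symm (fun _ => 1) then p.coeff m else 0 := by
    intro m hm
    have hdeg : ∑ i, m i = Fintype.card σ := by
      have : Finsupp.weight (fun _ => 1) m = Fintype.card σ :=
        hp (MvPolynomial.mem_support_iff.1 hm)
      rwa [← Finsupp.degree_eq_weight_one, Finsupp.degree_eq_sum] at this
    have hiff : (∀ i, m i ≠ 0) ↔ m = Finsupp.equivFunOnFinite.symm (fun _ => 1) := by
      constructor
      · intro h0
        have h1 : ∑ i : σ, 1 = ∑ i, m i := by simp [hdeg]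
        have := (Finset.sum_eq_sum_iff_of_le
          (fun i _ => Nat.one_le_iff_ne_zero.2 (h0 i))).1 h1
        ext i
        simpa using (this i (Finset.mem_univ i)).symm
      · rintro rfl i
        simp
    have := sum_neg_one_pow_mul_prod_indicator m
    simp only [hiff] at this
    simp_rw [mul_left_comm _ (p.coeff m), ← Finset.mul_sum, this]
    simp
  rw [Finset.sum_congr rfl h, Finset.sum_ite_eq']
  split_ifs with hm
  · rfl
  · simpa using hm

theorem MvPolynomial.eq_of_eval_eq_of_nonneg {σ : Type*} {p q : MvPolynomial σ ℝ}
    (h : ∀ c : σ → ℝ, (∀ i, 0 ≤ c i) → p.eval c = q.eval c) : p = q :=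
  MvPolynomial.funext_set (fun _ => Set.Ici 0) (fun _ => Set.Ici_infinite 0)
    fun c hc => h c fun i => hc i trivial

/-- Homogeneity can be tested on the nonnegative orthant. -/
theorem MvPolynomial.isHomogeneous_of_eval_smul {σ : Type*} {p : MvPolynomial σ ℝ} {d : ℕ}
    (h : ∀ t : ℝ, 0 ≤ t → ∀ c : σ → ℝ, (∀ i, 0 ≤ c i) → p.eval (t • c) = t ^ d * p.eval c) :
    p.IsHomogeneous d := by
  classical
  -- Compare the coefficients of `p (2 c) = 2 ^ d * p c`.
  let q : MvPolynomial σ ℝ :=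
    ∑ m ∈ p.support, MvPolynomial.monomial m ((2 : ℝ) ^ m.degree * p.coeff m)
  have hq : q = MvPolynomial.C ((2 : ℝ) ^ d) * p := by
    refine MvPolynomial.eq_of_eval_eq_of_nonneg fun c hc => ?_
    rw [map_mul, MvPolynomial.eval_C, ← h 2 (by norm_num) c hc, map_sum, MvPolynomial.eval_eq]
    refine Finset.sum_congr rfl fun m _ => ?_
    rw [MvPolynomial.eval_monomial]
    simp only [Pi.smul_apply, smul_eq_mul, mul_pow, Finset.prod_mul_distrib,
      Finset.prod_pow_eq_pow_sum, Finsupp.prod, Finsupp.degree_apply]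
    ring
  intro m hm
  have h1 := congrArg (MvPolynomial.coeff m) hq
  rw [MvPolynomial.coeff_C_mul, MvPolynomial.coeff_sum] at h1
  simp only [MvPolynomial.coeff_monomial, Finset.sum_ite_eq', MvPolynomial.mem_support_iff.2 hm,
    if_true] at h1
  change Finsupp.weight (fun _ => 1) m = d
  rw [← Finsupp.degree_eq_weight_one]
  exact Nat.pow_right_injective le_rfl (by exact_mod_cast mul_right_cancel₀ hm h1)
end Coefficient

/-! ### The mixed volume formula -/

theorem exists_isVolumePolynomial {n : ℕ} {P : Fin n → Set (EuclideanSpace ℝ (Fin n))}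
    (hP : ∀ i, IsPolytope (P i)) : ∃ p, IsVolumePolynomial P p := by
  choose s hs hPs using fun i => (hP i).exists_finset_convexHull
  obtain rfl : P = fun i => convexHull ℝ (s i : Set _) := funext hPs
  exact exists_eval_eq_measureReal_sum_smul MeasureTheory.volume s hs

theorem IsVolumePolynomial.isHomogeneous {n : ℕ} {P : Fin n → Set (EuclideanSpace ℝ (Fin n))}
    {p : MvPolynomial (Fin n) ℝ} (hp : IsVolumePolynomial P p) : p.IsHomogeneous n := by
  refine MvPolynomial.isHomogeneous_of_eval_smul fun t ht c hc => ?_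
  rw [hp (t • c) fun i => mul_nonneg ht (hc i), hp c hc]
  have : ∑ i, (t • c) i • P i = t • ∑ i, c i • P i := by
    rw [Finset.smul_sum]
    exact Finset.sum_congr rfl fun i _ => by rw [Pi.smul_apply, smul_assoc]
  rw [this, MeasureTheory.measureReal_def, MeasureTheory.Measure.addHaar_smul, ENNReal.toReal_mul,
    ENNReal.toReal_ofReal (abs_nonneg _), finrank_euclideanSpace_fin, abs_of_nonneg (by positivity)]
  rfl

theorem IsVolumePolynomial.eval_indicator {n : ℕ} {P : Fin n → Set (EuclideanSpace ℝ (Fin n))}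
    (hP : ∀ i, (P i).Nonempty) {p : MvPolynomial (Fin n) ℝ} (hp : IsVolumePolynomial P p)
    (S : Finset (Fin n)) :
    p.eval (fun i => if i ∈ S then 1 else 0) = MeasureTheory.volume.real (∑ i ∈ S, P i) := by
  rw [hp _ fun i => by split_ifs <;> norm_num]
  congr 1
  rw [← Finset.sum_subset (Finset.subset_univ S)]
  · exact Finset.sum_congr rfl fun i hi => by simp [hi]
  · intro i _ hi
    simp [hi, Set.zero_smul_set (hP i)]

theorem proposition3p4 (n : ℕ) (hn : 1 ≤ n)
    (P : Fin n → Set (EuclideanSpace ℝ (Fin n))) (hP : ∀ i, IsPolytope (P i)) :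
    (∃! p : MvPolynomial (Fin n) ℝ, IsVolumePolynomial P p) ∧
    (volumePolynomial P).IsHomogeneous n ∧
    mixedVolume P =
      ∑ k ∈ Finset.range n, (-1 : ℝ) ^ k *
        ∑ S ∈ Finset.powersetCard (n - k) (Finset.univ : Finset (Fin n)),
          MeasureTheory.volume.real (∑ i ∈ S, P i) := by
  have hex := exists_isVolumePolynomial hP
  have hvp : IsVolumePolynomial P (volumePolynomial P) := Classical.epsilon_spec hex
  refine ⟨⟨volumePolynomial P, hvp, fun q hq => ?_⟩, hvp.isHomogeneous, ?_⟩
  · exact MvPolynomial.eq_of_eval_eq_of_nonneg fun c hc => by rw [hq c hc, hvp c hc]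
  have hhom : (volumePolynomial P).IsHomogeneous (Fintype.card (Fin n)) := by
    rw [Fintype.card_fin]; exact hvp.isHomogeneous
  have hempty : MeasureTheory.volume.real (0 : Set (EuclideanSpace ℝ (Fin n))) = 0 := by
    -- A point has volume zero only in positive dimension.
    have : Nonempty (Fin n) := ⟨⟨0, hn⟩⟩
    rw [← Set.singleton_zero, MeasureTheory.measureReal_def, MeasureTheory.measure_singleton,
      ENNReal.toReal_zero]
  rw [mixedVolume, hhom.coeff_one_eq_sum]
  simp only [hvp.eval_indicator fun i => (hP i).1, Fintype.card_fin]
  rw [← Finset.powerset_univ, Finset.sum_powerset, Finset.card_univ, Fintype.card_fin,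
    ← Finset.sum_range_reflect, Finset.sum_range_succ]
  simp only [add_tsub_cancel_right, tsub_self, Finset.powersetCard_zero, Finset.sum_singleton,
    Finset.sum_empty, hempty, mul_zero, add_zero]
  refine Finset.sum_congr rfl fun k hk => ?_
  rw [Finset.mul_sum]
  refine Finset.sum_congr rfl fun S hS => ?_
  rw [(Finset.mem_powersetCard.1 hS).2, Nat.sub_sub_self (Finset.mem_range.1 hk).le]
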